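/- Consider $K$ users. User $i$ sends a coherent state $|p_i+\mathrm{i}q_i\rangle$ through a channel of transmittance $T_i\in[0,1]$, where the $2K$ quadratures $p_1,q_1,\dots,p_K,q_K$ are independent and $p_i,q_i\sim\mathcal N(0,V_a^{(i)})$. The receiver decodes the users in the order $1,\dots,K$ by successive interference cancellation and heterodyne detection, so that for user $k$ it obtains both quadratures: for $X_i=p_i$ for all $i$, and likewise for $X_i=q_i$ for all $i$, $$Y_k=\sqrt{T_k}\,X_k+\sqrt{1-T_k}\,\varepsilon_k+\sum_{i=k+1}^K\sqrt{T_i}\,X_i+n_{\det},$$ where the excess noise $\varepsilon_k$ caused by the eavesdropper's collective attack has, in each quadrature, an arbitrary law of finite variance $W_k$, and the detection noise $n_{\det}$ has, in each quadrature, an arbitrary law of finite variance $\delta_{\det}^2>0$. The family of all signals, the family of all excess noises and the detection noise are mutually independent. Let $I(\cdot\,;\cdot)\in[0,\infty]$ denote mutual information in nats, i.e. the Kullback--Leibler divergence of the joint law from the product of the marginal laws, let $\log$ be the natural logarithm, and put $$I_k^{(\mathrm{low})}=\log\left[1+\frac{T_kV_a^{(k)}}{\sum_{i=k+1}^KV_a^{(i)}+(1-T_k)W_k+\delta_{\det}^2}\right].$$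 Then, for every $k=1,\dots,K$, the achievable key rate of user $k$ under heterodyne detection, that is, the mutual information between the pair $(p_k,q_k)$ and the pair $(Y_k^{p},Y_k^{q})$ of received quadratures, satisfies $$I\big((p_k,q_k);(Y_k^{p},Y_k^{q})\big)\ \ge\ I_k^{(\mathrm{low})},$$ and each quadrature contributes at least half of this bound: $I(p_k;Y_k^{p})\ge\tfrac12 I_k^{(\mathrm{low})}$ and $I(q_k;Y_k^{q})\ge\tfrac12 I_k^{(\mathrm{low})}$. -/

import Mathlib

open MeasureTheory ProbabilityTheory
open scoped NNReal ENNReal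

namespace NomaCVQKD

noncomputable section

/-- Mutual information `I(A;B)`, in nats and with values in `[0,∞]`: the Kullback–Leibler
divergence of the joint law of `(A, B)` from the product of the two marginal laws. -/
def mutualInfo {Ω α β : Type*} [MeasurableSpace Ω] [MeasurableSpace α] [MeasurableSpace β]
    (μ : Measure Ω) (A : Ω → α) (B : Ω → β) : ℝ≥0∞ :=
  InformationTheory.klDiv (μ.map (fun ω => (A ω, B ω))) ((μ.map A).prod (μ.map B))

/-- The total interference
`n_k = ∑_{i>k} √T_i X_i + √(1 - T_k) ε_k + n_det` in the quadrature `c` of user `k`.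
The two values of `c : Fin 2` stand for the amplitude and the phase quadrature. -/
def interference {Ω : Type*} {K : ℕ} (T : Fin K → ℝ) (X ε : Fin K → Fin 2 → Ω → ℝ)
    (nDet : Fin 2 → Ω → ℝ) (k : Fin K) (c : Fin 2) (ω : Ω) : ℝ :=
  (∑ i ∈ Finset.Ioi k, √(T i) * X i c ω) + √(1 - T k) * ε k c ω + nDet c ω

/-- The received signal
`Y_k = √T_k X_k + √(1 - T_k) ε_k + ∑_{i>k} √T_i X_i + n_det` in the quadrature `c`,
after the signals of the users before `k` have been decoded and cancelled. -/
def received {Ω : Type*} {K : ℕ} (T : Fin K → ℝ) (X ε : Fin K → Fin 2 → Ω → ℝ)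
    (nDet : Fin 2 → Ω → ℝ) (k : Fin K) (c : Fin 2) (ω : Ω) : ℝ :=
  √(T k) * X k c ω + interference T X ε nDet k c ω

/-- The achievable key rate of user `k` with heterodyne detection, which measures both
quadratures of the coherent state: the mutual information between the two modulated
quadratures and the two received quadratures. -/
def keyRate {Ω : Type*} [MeasurableSpace Ω] (μ : Measure Ω) {K : ℕ} (T : Fin K → ℝ)
    (X ε : Fin K → Fin 2 → Ω → ℝ) (nDet : Fin 2 → Ω → ℝ) (k : Fin K) : ℝ≥0∞ :=
  mutualInfo μ (fun ω c => X k c ω) (fun ω c => received T X ε nDet k c ω)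

/-- `I_k^(low) = log (1 + T_k V_k / (∑_{i>k} V_i + (1 - T_k) W_k + δ_det²))`. -/
def rateLow {K : ℕ} (T : Fin K → ℝ) (V : Fin K → ℝ≥0) (W : Fin K → ℝ) (δdet : ℝ)
    (k : Fin K) : ℝ :=
  Real.log (1 + T k * (V k : ℝ) /
    ((∑ i ∈ Finset.Ioi k, (V i : ℝ)) + (1 - T k) * W k + δdet ^ 2))

/-- The uplink with `K` users: independent centred Gaussian quadratures `X i c` of variance
`V i`; excess noise `ε i` of arbitrary law with variance `W i` in each quadrature; detection
noise `nDet` of arbitrary law with variance `δdet² > 0` in each quadrature. The signals, the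
excess noise and the detection noise are mutually independent (the last two conditions);
dependence within the excess noise and within the detection noise is not excluded. -/
structure IsUplink {Ω : Type*} [MeasurableSpace Ω] (μ : Measure Ω) {K : ℕ}
    (T : Fin K → ℝ) (V : Fin K → ℝ≥0) (W : Fin K → ℝ) (δdet : ℝ)
    (X ε : Fin K → Fin 2 → Ω → ℝ) (nDet : Fin 2 → Ω → ℝ) : Prop where
  transmittance : ∀ i, T i ∈ Set.Icc (0 : ℝ) 1
  δdet_pos : 0 < δdet
  measurable_X : ∀ i c, Measurable (X i c)
  measurable_ε : ∀ i c, Measurable (ε i c)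
  measurable_nDet : ∀ c, Measurable (nDet c)
  gaussian_X : ∀ i c, μ.map (X i c) = gaussianReal 0 (V i)
  memLp_ε : ∀ i c, MemLp (ε i c) 2 μ
  variance_ε : ∀ i c, variance (ε i c) μ = W i
  memLp_nDet : ∀ c, MemLp (nDet c) 2 μ
  variance_nDet : ∀ c, variance (nDet c) μ = δdet ^ 2
  indep_X : iIndepFun (fun (j : Fin K × Fin 2) => X j.1 j.2) μ
  indep_signal_noise :
    IndepFun (fun ω (i : Fin K) (c : Fin 2) => X i c ω)
      (fun ω => ((fun (i : Fin K) (c : Fin 2) => ε i c ω), (fun (c : Fin 2) => nDet c ω))) μ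
  indep_excess_detection :
    IndepFun (fun ω (i : Fin K) (c : Fin 2) => ε i c ω) (fun ω (c : Fin 2) => nDet c ω) μ

end

end NomaCVQKD

/-! Gaussian noise is the worst case for a Gaussian input. By Donsker–Varadhan, the mutual
information is at least the joint mean of any `f` whose exponential has mean one under the product
of the marginals. Take for `f` the log density ratio of a fictitious channel with Gaussian noise of
variance `D`, the denominator in `rateLow`. Bayes normalisation against the Gaussian input gives the
mean-one condition for each fixed output `y` (`lintegral_exp_gaussianLogRatio`), so the true output
law is irrelevant. As `f` is quadratic, its joint mean involves only second moments and is at least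
half of `rateLow` once the true noise variance is at most `D`
(`half_log_le_integral_gaussianLogRatio`). For both quadratures the two test functions are added. -/

namespace NomaCVQKD

/-! ### Variational bounds on divergence and mutual information. -/

/-- Donsker–Varadhan lower bound for an exponentially normalised test function. -/
lemma ofReal_integral_le_klDiv {α : Type*} [MeasurableSpace α] {P Q : Measure α}
    [IsProbabilityMeasure P] [IsProbabilityMeasure Q] {f : α → ℝ} (hf : Measurable f)
    (hfP : Integrable f P) (hfQ : ∫⁻ x, ENNReal.ofReal (Real.exp (f x)) ∂Q = 1) :
    ENNReal.ofReal (∫ x, f x ∂P) ≤ InformationTheory.klDiv P Q := by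
  by_cases htop : InformationTheory.klDiv P Q = ∞
  · simp [htop]
  obtain ⟨hac, hllr⟩ := InformationTheory.klDiv_ne_top_iff.mp htop
  have hexp : Integrable (fun x => Real.exp (f x)) Q := by
    refine ⟨by fun_prop, ?_⟩
    rw [hasFiniteIntegral_iff_ofReal (ae_of_all _ fun _ => (Real.exp_pos _).le), hfQ]
    exact ENNReal.one_lt_top
  have hint : ∫ x, Real.exp (f x) ∂Q = 1 := by
    rw [integral_eq_lintegral_of_nonneg_ae (ae_of_all _ fun _ => (Real.exp_pos _).le)
      hexp.aestronglyMeasurable, hfQ, ENNReal.toReal_one]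
  have := isProbabilityMeasure_tilted hexp
  have hac' : P ≪ Q.tilted f := hac.trans (absolutelyContinuous_tilted hexp)
  -- The whole inequality is nonnegativity of the divergence from the tilted measure, which equals
  -- the divergence from `Q` minus `∫ f ∂P`.
  have hnonneg : 0 ≤ ∫ x, llr P (Q.tilted f) x ∂P := by
    rw [← InformationTheory.toReal_klDiv_of_measure_eq hac' (by simp)]
    exact ENNReal.toReal_nonneg
  rw [integral_llr_tilted_right hac hfP hexp hllr, hint, Real.log_one, add_zero] at hnonneg
  rw [InformationTheory.klDiv_of_ac_of_integrable hac hllr]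
  refine ENNReal.ofReal_le_ofReal ?_
  simp only [probReal_univ]
  linarith

/-- A lower bound on mutual information from a test function `f` for which `exp (f (A, y))` has
mean one for every `y`. -/
lemma ofReal_integral_le_mutualInfo {Ω α β : Type*} [MeasurableSpace Ω] [MeasurableSpace α]
    [MeasurableSpace β] {μ : Measure Ω} [IsProbabilityMeasure μ] {A : Ω → α} {B : Ω → β}
    (hA : Measurable A) (hB : Measurable B) {f : α × β → ℝ} (hf : Measurable f)
    (hint : Integrable (fun ω => f (A ω, B ω)) μ)
    (hexp : ∀ y, ∫⁻ ω, ENNReal.ofReal (Real.exp (f (A ω, y))) ∂μ = 1) :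
    ENNReal.ofReal (∫ ω, f (A ω, B ω) ∂μ) ≤ mutualInfo μ A B := by
  have hAB : Measurable fun ω => (A ω, B ω) := hA.prodMk hB
  have := Measure.isProbabilityMeasure_map hA.aemeasurable (μ := μ)
  have := Measure.isProbabilityMeasure_map hB.aemeasurable (μ := μ)
  have := Measure.isProbabilityMeasure_map hAB.aemeasurable (μ := μ)
  have hle := ofReal_integral_le_klDiv (P := μ.map fun ω => (A ω, B ω))
    (Q := (μ.map A).prod (μ.map B)) hf
    ((integrable_map_measure hf.aestronglyMeasurable hAB.aemeasurable).mpr hint) (by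
      rw [lintegral_prod_symm' _ (by fun_prop)]
      have hy (y : β) : ∫⁻ x, ENNReal.ofReal (Real.exp (f (x, y))) ∂(μ.map A) = 1 := by
        rw [lintegral_map (by fun_prop) hA, hexp y]
      simp [hy])
  rwa [integral_map hAB.aemeasurable hf.aestronglyMeasurable] at hle

/-! ### The Gaussian test function. -/

/-- The logarithm of the ratio of the density at `y` of `N(a x + m, D)` to the density at `y` of
`N(m, a² V + D)`. -/
noncomputable def gaussianLogRatio (a V D m : ℝ) (p : ℝ × ℝ) : ℝ :=
  Real.log (1 + a ^ 2 * V / D) / 2 - (p.2 - a * p.1 - m) ^ 2 / (2 * D)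
    + (p.2 - m) ^ 2 / (2 * (a ^ 2 * V + D))

@[fun_prop]
lemma measurable_gaussianLogRatio (a V D m : ℝ) : Measurable (gaussianLogRatio a V D m) := by
  unfold gaussianLogRatio
  fun_prop

/-- Prior density times likelihood ratio is the posterior density of the input given the output `y`;
completing the square shows it is again Gaussian. -/
lemma lintegral_exp_gaussianLogRatio (a m y : ℝ) (V : ℝ≥0) {D : ℝ} (hD : 0 < D) :
    ∫⁻ x, ENNReal.ofReal (Real.exp (gaussianLogRatio a V D m (x, y))) ∂(gaussianReal 0 V) = 1 := by
  rcases eq_or_ne V 0 with rfl | hV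
  · simp [gaussianLogRatio]
  have hVpos : (0 : ℝ) < V := by positivity
  have hS : 0 < a ^ 2 * (V : ℝ) + D := by positivity
  -- Posterior variance `(1/V + a²/D)⁻¹`; the posterior mean is `a V (y - m) / (a² V + D)`.
  let V' : ℝ≥0 := ⟨V * D / (a ^ 2 * V + D), by positivity⟩
  have hV'val : (V' : ℝ) = V * D / (a ^ 2 * V + D) := rfl
  have hV' : V' ≠ 0 := by
    rw [← NNReal.coe_ne_zero, hV'val]
    positivity
  rw [gaussianReal_of_var_ne_zero _ hV,
    lintegral_withDensity_eq_lintegral_mul _ (measurable_gaussianPDF _ _)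
      (by fun_prop),
    ← lintegral_gaussianPDF_eq_one (a * V * (y - m) / (a ^ 2 * V + D)) hV']
  refine lintegral_congr fun x => ?_
  simp only [Pi.mul_apply, gaussianPDF]
  rw [← ENNReal.ofReal_mul (gaussianPDFReal_nonneg _ _ _)]
  congr 1
  have hr : 0 < 1 + a ^ 2 * V / D := by positivity
  have hlog : Real.exp (Real.log (1 + a ^ 2 * V / D) / 2) = √(1 + a ^ 2 * V / D) := by
    rw [Real.exp_half, Real.exp_log hr]
  have hsqrt : (√(2 * Real.pi * V'))⁻¹ = (√(2 * Real.pi * V))⁻¹ * √(1 + a ^ 2 * V / D) := by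
    rw [← Real.sqrt_inv, ← Real.sqrt_inv, ← Real.sqrt_mul (by positivity), hV'val]
    congr 1
    field_simp
    ring
  have hexponent : -(x - a * V * (y - m) / (a ^ 2 * V + D)) ^ 2 / (2 * (V' : ℝ)) =
      -(x - 0) ^ 2 / (2 * V) + (-((y - a * x - m) ^ 2 / (2 * D))
        + (y - m) ^ 2 / (2 * (a ^ 2 * V + D))) := by
    rw [hV'val]
    field_simp
    ring
  rw [gaussianPDFReal, gaussianPDFReal, hsqrt, hexponent, Real.exp_add, ← hlog, gaussianLogRatio,
    show ∀ r s t : ℝ, r - s + t = r + (-s + t) by intros; ring, Real.exp_add]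
  ring

/-! ### Second-moment estimates. -/

section Moments

variable {Ω : Type*} [MeasurableSpace Ω] {μ : Measure Ω} [IsProbabilityMeasure μ]

lemma integrable_sub_const_sq {Z : Ω → ℝ} (hZ : MemLp Z 2 μ) (m : ℝ) :
    Integrable (fun ω => (Z ω - m) ^ 2) μ :=
  (hZ.sub (memLp_const m)).integrable_sq

lemma integrable_gaussianLogRatio {A B : Ω → ℝ} (hA : MemLp A 2 μ) (hB : MemLp B 2 μ)
    (a V D m : ℝ) : Integrable (fun ω => gaussianLogRatio a V D m (A ω, B ω)) μ := by
  unfold gaussianLogRatio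
  exact ((integrable_const _).sub
    ((integrable_sub_const_sq (hB.sub (hA.const_mul a)) m).div_const _)).add
    ((integrable_sub_const_sq hB m).div_const _)

/-- A centred signal `A`, received as `B = a A + N` with `Var B = a² V + Var N` and `Var N ≤ D`,
has expected Gaussian log-ratio at least the Gaussian capacity at noise level `D`. -/
lemma half_log_le_integral_gaussianLogRatio {A N : Ω → ℝ} (hA : MemLp A 2 μ) (hN : MemLp N 2 μ)
    {a V D : ℝ} (hV : 0 ≤ V) (hD : 0 < D) (hA0 : μ[A] = 0)
    (hvar : variance (fun ω => a * A ω + N ω) μ = a ^ 2 * V + variance N μ)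
    (hND : variance N μ ≤ D) :
    Real.log (1 + a ^ 2 * V / D) / 2 ≤
      ∫ ω, gaussianLogRatio a V D (μ[N]) (A ω, a * A ω + N ω) ∂μ := by
  have hB : MemLp (fun ω => a * A ω + N ω) 2 μ := (hA.const_mul a).add hN
  have hmean : μ[fun ω => a * A ω + N ω] = μ[N] := by
    rw [integral_add ((hA.integrable one_le_two).const_mul a) (hN.integrable one_le_two),
      integral_const_mul, hA0]
    simp
  have hIB : ∫ ω, (a * A ω + N ω - μ[N]) ^ 2 ∂μ = a ^ 2 * V + variance N μ := by
    rw [← hvar, variance_eq_integral hB.aemeasurable, hmean]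
  have hIN : ∫ ω, (a * A ω + N ω - a * A ω - μ[N]) ^ 2 ∂μ = variance N μ := by
    rw [variance_eq_integral hN.aemeasurable]
    simp
  have hi0 : Integrable (fun _ => Real.log (1 + a ^ 2 * V / D) / 2) μ := integrable_const _
  have hi1 : Integrable (fun ω => (a * A ω + N ω - a * A ω - μ[N]) ^ 2 / (2 * D)) μ :=
    (integrable_sub_const_sq (hB.sub (hA.const_mul a)) _).div_const _
  have hi2 : Integrable (fun ω => (a * A ω + N ω - μ[N]) ^ 2 / (2 * (a ^ 2 * V + D))) μ :=
    (integrable_sub_const_sq hB _).div_const _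
  simp only [gaussianLogRatio]
  rw [integral_add (hi0.sub' hi1) hi2, integral_sub hi0 hi1,
    integral_div, integral_div, integral_div, hIB, hIN, integral_const, probReal_univ, one_smul]
  -- Clearing denominators leaves `a² V (D - Var N) ≥ 0`; the quadratic terms cancel exactly when
  -- the noise variance is `D`.
  have hle : variance N μ / (2 * D) ≤ (a ^ 2 * V + variance N μ) / (2 * (a ^ 2 * V + D)) := by
    rw [div_le_div_iff₀ (by positivity) (by positivity)]
    nlinarith [mul_nonneg (mul_nonneg (sq_nonneg a) hV) (sub_nonneg.mpr hND)]
  linarith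

end Moments

/-! ### Moments of the uplink and the rate bounds. -/

namespace IsUplink

variable {Ω : Type*} [MeasurableSpace Ω] {μ : Measure Ω} {K : ℕ}
  {T : Fin K → ℝ} {V : Fin K → ℝ≥0} {W : Fin K → ℝ} {δdet : ℝ} {X ε : Fin K → Fin 2 → Ω → ℝ}
  {nDet : Fin 2 → Ω → ℝ}

lemma memLp_X (h : IsUplink μ T V W δdet X ε nDet) (i : Fin K) (c : Fin 2) :
    MemLp (X i c) 2 μ := by
  have hid : MemLp id 2 (μ.map (X i c)) := by
    rw [h.gaussian_X]
    exact memLp_id_gaussianReal 2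
  exact (memLp_map_measure_iff hid.aestronglyMeasurable (h.measurable_X i c).aemeasurable).mp hid

lemma integral_X (h : IsUplink μ T V W δdet X ε nDet) (i : Fin K) (c : Fin 2) :
    μ[X i c] = 0 := by
  have hmap := integral_map (μ := μ) (h.measurable_X i c).aemeasurable
    (f := fun x : ℝ => x) (by fun_prop)
  rw [← hmap, h.gaussian_X, integral_id_gaussianReal]

lemma variance_X (h : IsUplink μ T V W δdet X ε nDet) (i : Fin K) (c : Fin 2) :
    variance (X i c) μ = V i := by
  rw [← variance_id_map (h.measurable_X i c).aemeasurable, h.gaussian_X, variance_id_gaussianReal]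

lemma memLp_sum (h : IsUplink μ T V W δdet X ε nDet) (s : Finset (Fin K)) (c : Fin 2) :
    MemLp (fun ω => ∑ i ∈ s, √(T i) * X i c ω) 2 μ :=
  memLp_finsetSum s fun i _ => (h.memLp_X i c).const_mul _

lemma memLp_noise (h : IsUplink μ T V W δdet X ε nDet) (k : Fin K) (c : Fin 2) :
    MemLp (fun ω => √(1 - T k) * ε k c ω + nDet c ω) 2 μ :=
  ((h.memLp_ε k c).const_mul _).add (h.memLp_nDet c)

lemma variance_sum (h : IsUplink μ T V W δdet X ε nDet) (s : Finset (Fin K)) (c : Fin 2) :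
    variance (fun ω => ∑ i ∈ s, √(T i) * X i c ω) μ = ∑ i ∈ s, T i * V i := by
  have hsum := IndepFun.variance_sum (μ := μ) (X := fun i ω => √(T i) * X i c ω) (s := s)
    (fun i _ => (h.memLp_X i c).const_mul _) (fun i _ j _ hij =>
      (h.indep_X.indepFun (i := (i, c)) (j := (j, c)) (by simpa using hij)).comp
        (measurable_const_mul (√(T i))) (measurable_const_mul (√(T j))))
  have heq : (fun ω => ∑ i ∈ s, √(T i) * X i c ω) = ∑ i ∈ s, fun ω => √(T i) * X i c ω := by
    ext ω
    simp
  rw [heq, hsum]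
  refine Finset.sum_congr rfl fun i _ => ?_
  rw [variance_const_mul, h.variance_X, Real.sq_sqrt (h.transmittance i).1]

lemma variance_noise (h : IsUplink μ T V W δdet X ε nDet) (k : Fin K) (c : Fin 2) :
    variance (fun ω => √(1 - T k) * ε k c ω + nDet c ω) μ = (1 - T k) * W k + δdet ^ 2 := by
  have hind : IndepFun (fun ω => √(1 - T k) * ε k c ω) (nDet c) μ :=
    h.indep_excess_detection.comp (φ := fun e : Fin K → Fin 2 → ℝ => √(1 - T k) * e k c)
      (ψ := fun d : Fin 2 → ℝ => d c) (by fun_prop) (by fun_prop)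
  rw [hind.variance_fun_add ((h.memLp_ε k c).const_mul _) (h.memLp_nDet c), variance_const_mul,
    h.variance_ε, h.variance_nDet, Real.sq_sqrt (sub_nonneg.mpr (h.transmittance k).2)]

/-- Stated for any `s` to serve both the interference (`Ioi k`) and the received signal (`Ici k`).
-/
lemma variance_sum_add_noise (h : IsUplink μ T V W δdet X ε nDet) (s : Finset (Fin K))
    (k : Fin K) (c : Fin 2) :
    variance (fun ω => (∑ i ∈ s, √(T i) * X i c ω) + (√(1 - T k) * ε k c ω + nDet c ω)) μ =
      (∑ i ∈ s, T i * V i) + ((1 - T k) * W k + δdet ^ 2) := by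
  have hind : IndepFun (fun ω => ∑ i ∈ s, √(T i) * X i c ω)
      (fun ω => √(1 - T k) * ε k c ω + nDet c ω) μ :=
    h.indep_signal_noise.comp
      (φ := fun x : Fin K → Fin 2 → ℝ => ∑ i ∈ s, √(T i) * x i c)
      (ψ := fun p : (Fin K → Fin 2 → ℝ) × (Fin 2 → ℝ) => √(1 - T k) * p.1 k c + p.2 c)
      (by fun_prop) (by fun_prop)
  rw [hind.variance_fun_add (h.memLp_sum s c) (h.memLp_noise k c), h.variance_sum,
    h.variance_noise]

lemma memLp_interference (h : IsUplink μ T V W δdet X ε nDet) (k : Fin K) (c : Fin 2) :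
    MemLp (interference T X ε nDet k c) 2 μ :=
  ((h.memLp_sum _ c).add ((h.memLp_ε k c).const_mul _)).add (h.memLp_nDet c)

lemma memLp_received (h : IsUplink μ T V W δdet X ε nDet) (k : Fin K) (c : Fin 2) :
    MemLp (received T X ε nDet k c) 2 μ :=
  ((h.memLp_X k c).const_mul _).add (h.memLp_interference k c)

lemma measurable_received (h : IsUplink μ T V W δdet X ε nDet) (k : Fin K) (c : Fin 2) :
    Measurable (received T X ε nDet k c) := by
  have := h.measurable_X
  have := h.measurable_ε
  have := h.measurable_nDet
  unfold received interference
  fun_prop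

lemma variance_interference (h : IsUplink μ T V W δdet X ε nDet) (k : Fin K) (c : Fin 2) :
    variance (interference T X ε nDet k c) μ =
      (∑ i ∈ Finset.Ioi k, T i * V i) + ((1 - T k) * W k + δdet ^ 2) := by
  rw [← h.variance_sum_add_noise _ k c]
  congr 1
  ext ω
  simp only [interference]
  ring

lemma variance_received (h : IsUplink μ T V W δdet X ε nDet) (k : Fin K) (c : Fin 2) :
    variance (received T X ε nDet k c) μ =
      T k * V k + variance (interference T X ε nDet k c) μ := by
  have hIci : Finset.Ici k = insert k (Finset.Ioi k) := (Finset.Ioi_insert k).symm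
  have hsum := h.variance_sum_add_noise (Finset.Ici k) k c
  simp only [hIci, Finset.sum_insert Finset.notMem_Ioi_self] at hsum
  rw [h.variance_interference, ← add_assoc, ← hsum]
  congr 1
  ext ω
  simp only [received, interference]
  ring

lemma variance_interference_le (h : IsUplink μ T V W δdet X ε nDet) (k : Fin K) (c : Fin 2) :
    variance (interference T X ε nDet k c) μ ≤
      (∑ i ∈ Finset.Ioi k, (V i : ℝ)) + (1 - T k) * W k + δdet ^ 2 := by
  rw [h.variance_interference, add_assoc]
  gcongr with i
  -- Bounding `T i` by one is why the sum in `rateLow` carries no transmittances.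
  exact mul_le_of_le_one_left (V i).2 (h.transmittance i).2

lemma noise_bound_pos (h : IsUplink μ T V W δdet X ε nDet) (k : Fin K) :
    0 < (∑ i ∈ Finset.Ioi k, (V i : ℝ)) + (1 - T k) * W k + δdet ^ 2 := by
  have hW : 0 ≤ W k := h.variance_ε k 0 ▸ variance_nonneg _ _
  have hT := sub_nonneg.mpr (h.transmittance k).2
  have hδ := h.δdet_pos
  positivity

lemma lintegral_exp_gaussianLogRatio_X (h : IsUplink μ T V W δdet X ε nDet) (k : Fin K)
    (c : Fin 2) (a m y : ℝ) {D : ℝ} (hD : 0 < D) :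
    ∫⁻ ω, ENNReal.ofReal (Real.exp (gaussianLogRatio a (V k) D m (X k c ω, y))) ∂μ = 1 := by
  rw [← lintegral_exp_gaussianLogRatio a m y (V k) hD, ← h.gaussian_X k c, lintegral_map (by fun_prop)
    (h.measurable_X k c)]

variable [IsProbabilityMeasure μ]

lemma half_rateLow_le_integral (h : IsUplink μ T V W δdet X ε nDet) (k : Fin K) (c : Fin 2) :
    rateLow T V W δdet k / 2 ≤
      ∫ ω, gaussianLogRatio (√(T k)) (V k)
        ((∑ i ∈ Finset.Ioi k, (V i : ℝ)) + (1 - T k) * W k + δdet ^ 2)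
        (μ[interference T X ε nDet k c]) (X k c ω, received T X ε nDet k c ω) ∂μ := by
  have hsq := Real.sq_sqrt (h.transmittance k).1
  have hvar := h.variance_received k c
  rw [← hsq] at hvar
  have hle := half_log_le_integral_gaussianLogRatio (h.memLp_X k c) (h.memLp_interference k c)
    (V k).2 (h.noise_bound_pos k) (h.integral_X k c) hvar (h.variance_interference_le k c)
  rwa [hsq] at hle

/-- Each quadrature carries at least half of the rate bound. -/
lemma half_rateLow_le_mutualInfo (h : IsUplink μ T V W δdet X ε nDet) (k : Fin K) (c : Fin 2) :
    ENNReal.ofReal (rateLow T V W δdet k / 2) ≤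
      mutualInfo μ (X k c) (received T X ε nDet k c) :=
  (ENNReal.ofReal_le_ofReal (h.half_rateLow_le_integral k c)).trans <|
    ofReal_integral_le_mutualInfo (h.measurable_X k c) (h.measurable_received k c)
      (measurable_gaussianLogRatio _ _ _ _)
      (integrable_gaussianLogRatio (h.memLp_X k c) (h.memLp_received k c) _ _ _ _)
      fun y => h.lintegral_exp_gaussianLogRatio_X k c _ _ y (h.noise_bound_pos k)

/-- Both quadratures together carry at least the rate bound, even when the noises of the two
quadratures are dependent. -/
lemma rateLow_le_keyRate (h : IsUplink μ T V W δdet X ε nDet) (k : Fin K) :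
    ENNReal.ofReal (rateLow T V W δdet k) ≤ keyRate μ T X ε nDet k := by
  let D := (∑ i ∈ Finset.Ioi k, (V i : ℝ)) + (1 - T k) * W k + δdet ^ 2
  let f (c : Fin 2) : ℝ × ℝ → ℝ :=
    gaussianLogRatio (√(T k)) (V k) D (μ[interference T X ε nDet k c])
  have hfm (c : Fin 2) : Measurable (f c) := measurable_gaussianLogRatio _ _ _ _
  have hfi (c : Fin 2) : Integrable (fun ω => f c (X k c ω, received T X ε nDet k c ω)) μ :=
    integrable_gaussianLogRatio (h.memLp_X k c) (h.memLp_received k c) _ _ _ _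
  have hrate : rateLow T V W δdet k ≤
      ∫ ω, ∑ c, f c (X k c ω, received T X ε nDet k c ω) ∂μ := by
    rw [integral_finsetSum _ fun c _ => hfi c, Fin.sum_univ_two]
    linarith [h.half_rateLow_le_integral k 0, h.half_rateLow_le_integral k 1]
  refine (ENNReal.ofReal_le_ofReal hrate).trans ?_
  have hindep : iIndepFun (fun c => X k c) μ :=
    h.indep_X.precomp (g := fun c : Fin 2 => (k, c)) (Prod.mk_right_injective k)
  refine ofReal_integral_le_mutualInfo (f := fun p => ∑ c, f c (p.1 c, p.2 c))
    (measurable_pi_lambda _ fun c => h.measurable_X k c)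
    (measurable_pi_lambda _ fun c => h.measurable_received k c) (by fun_prop)
    (integrable_finsetSum _ fun c _ => hfi c) fun y => ?_
  have hgm (c : Fin 2) : Measurable fun x : ℝ => ENNReal.ofReal (Real.exp (f c (x, y c))) := by
    fun_prop
  have hX := h.measurable_X k
  -- With `y` frozen only the two signal quadratures are random, so their independence alone
  -- factorises the mean.
  have hprod := lintegral_prod_eq_prod_lintegral_of_indepFun Finset.univ
    (fun c ω => ENNReal.ofReal (Real.exp (f c (X k c ω, y c))))
    (hindep.comp _ hgm) fun c => (hgm c).comp (hX c)
  simp only [Real.exp_sum, ENNReal.ofReal_prod_of_nonneg fun _ _ => (Real.exp_pos _).le]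
  rw [hprod]
  exact Finset.prod_eq_one fun c _ =>
    h.lintegral_exp_gaussianLogRatio_X k c _ _ (y c) (h.noise_bound_pos k)

end IsUplink

end NomaCVQKD

theorem lemma2 {Ω : Type*} [MeasurableSpace Ω] (μ : Measure Ω) [IsProbabilityMeasure μ]
    {K : ℕ} (T : Fin K → ℝ) (V : Fin K → ℝ≥0) (W : Fin K → ℝ) (δdet : ℝ)
    (X ε : Fin K → Fin 2 → Ω → ℝ) (nDet : Fin 2 → Ω → ℝ)
    (h : NomaCVQKD.IsUplink μ T V W δdet X ε nDet) (k : Fin K) :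
    ENNReal.ofReal (NomaCVQKD.rateLow T V W δdet k) ≤ NomaCVQKD.keyRate μ T X ε nDet k ∧
    ∀ c : Fin 2, ENNReal.ofReal (NomaCVQKD.rateLow T V W δdet k / 2) ≤
      NomaCVQKD.mutualInfo μ (X k c) (NomaCVQKD.received T X ε nDet k c) := by
  exact ⟨h.rateLow_le_keyRate k, h.half_rateLow_le_mutualInfo k⟩
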